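/- Let $C_2=\{1,-1\}$, let $\widehat{C_2}=\{\mathbf{trv},\mathbf{sgn}\}$ be its character group, and let $n\ge 0$. For a set $L$, let $\Gamma_n[L]$ be the set of $L$-compositions $p=((a_1,h_1),\dots,(a_k,h_k))$ of $n$ ($a_i\ge 1$, $\sum_i a_i=n$, $h_i\in L$) and $\Lambda_n[L]$ the set of $L$-partitions of $n$ (multisets of such pairs). Write $\ell$ for the number of blocks, $|p|=(a_1,\dots,a_k)$ for the underlying composition, and $\mathsf{supp}(p)\in\Lambda_n[L]$ for the multiset of blocks of $p$. For $p,q\in\Gamma_n[L]$, write $p\le q$ if $q$ is a label-preserving refinement of $p$, i.e. $q$ is obtained by replacing each block $(a_i,h_i)$ of $p$ by a sequence of $\ell_i$ blocks, all labelled $h_i$, with sizes adding up to $a_i$; then $\deg(q/p):=\prod_i \ell_i$. Let $\mathfrak B_n=\mathfrak S_n[C_2]$ be the group of signed permutations $((\sigma_1,g_1),\dots,(\sigma_n,g_n))$, $\sigma\in\mathfrak S_n$, $g_i\in C_2$, with product $((\sigma_i,g_i))_i\cdot((\tau_i,h_i))_i=((\sigma_{\tau_i},g_{\tau_i}h_i))_i$.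 Let $\mathrm{co}(\sigma,g)\in\Gamma_n[C_2]$ be the coarsest $C_2$-composition of $n$ along each of whose blocks $\sigma$ is increasing and $g$ is constant, equal to the label of the block. In $\mathbb C\mathfrak B_n$ put, for $p\in\Gamma_n[C_2]$, $$Y_p=\sum_{\mathrm{co}(w)=p}w,\qquad X_p=\sum_{q\in\Gamma_n[C_2],\ q\le p}Y_q ;$$ these elements span the type B Mantaci–Reutenauer algebra ${\sf MR}_n[C_2]$. On $\bigoplus_{n\ge0}\mathbb C\mathfrak B_n$ let $\star$ be the bilinear product with $u\star v=\sum_{w}w\cdot(u\times v)$ for $u\in\mathfrak B_n$, $v\in\mathfrak B_m$, the sum being over all $w\in\mathfrak S_{n+m}$ with $w_1<\dots<w_n$ and $w_{n+1}<\dots<w_{n+m}$; the empty $\star$-product is the identity of $\mathfrak B_0$. For $n\ge1$ let $$r_n=\sum_{c}\frac{(-1)^{\ell(c)-1}}{\ell(c)}X_{c},\qquad \overline{r_n}=\sum_{c}\frac{(-1)^{\ell(c)-1}}{\ell(c)}X_{\overline c},$$ both sums over all compositions $c$ of $n$, where in $X_c$ (resp. $X_{\overline c}$) all blocks of $c$ are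 labelled $1$ (resp. $-1$). Put $\mathcal I_{(n,\mathbf{trv})}=\frac12(r_n+\overline{r_n})$ and $\mathcal I_{(n,\mathbf{sgn})}=\frac12(r_n-\overline{r_n})$, and $\mathcal I_\alpha=\mathcal I_{\alpha_1}\star\cdots\star\mathcal I_{\alpha_k}$ for $\alpha=(\alpha_1,\dots,\alpha_k)\in\Gamma_n[\widehat{C_2}]$. For $\lambda\in\Lambda_n[\widehat{C_2}]$, Vazirani's idempotent is $$\mathfrak g_\lambda=\frac1{\ell(\lambda)!}\sum_{\alpha\in\Gamma_n[\widehat{C_2}],\ \mathsf{supp}(\alpha)=\lambda}\mathcal I_\alpha .$$ For $\alpha\in\Gamma_n[\widehat{C_2}]$ with labels $\chi_1,\dots,\chi_k$ and $p\in\Gamma_n[C_2]$ with labels $h_1,\dots,h_k$ and $|p|=|\alpha|$, let $\alpha(p)=\prod_i\chi_i(h_i)$. **Corollary.** For every $\lambda\in\Lambda_n[\widehat{C_2}]$, $$\mathfrak g_\lambda=\frac{1}{2^{\ell(\lambda)}\,\ell(\lambda)!}\sum_{\substack{\alpha\in\Gamma_n[\widehat{C_2}]\\ \mathsf{supp}(\alpha)=\lambda}}\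 \sum_{\substack{p\in\Gamma_n[C_2]\\ |p|=|\alpha|}}\overline{\alpha(p)}\sum_{\substack{q\in\Gamma_n[C_2]\\ p\le q}}\frac{(-1)^{\ell(q)-\ell(p)}}{\deg(q/p)}\,X_q .$$ -/

import Mathlib

open scoped DirectSum

noncomputable section

namespace MR

/-- `Γ_n[L]`: compositions of `n` whose blocks carry labels in `L`, written as the list
`((a₁, h₁), …, (a_k, h_k))` of (size, label). -/
@[ext] structure GComp (L : Type) (n : ℕ) where
  blocks : List (ℕ × L)
  pos : ∀ b ∈ blocks, 0 < b.1
  sum_eq : (blocks.map Prod.fst).sum = n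

/-- `Λ_n[L]`: partitions of `n` whose blocks carry labels in `L`, i.e. multisets of (size, label). -/
@[ext] structure GPart (L : Type) (n : ℕ) where
  blocks : Multiset (ℕ × L)
  pos : ∀ b ∈ blocks, 0 < b.1
  sum_eq : (blocks.map Prod.fst).sum = n

/-- The length `ℓ(λ)`: the number of blocks. -/
def GPart.length {L : Type} {n : ℕ} (lam : GPart L n) : ℕ := lam.blocks.card

namespace GComp

variable {L : Type} {n : ℕ}

/-- The length `ℓ(p)`: the number of blocks. -/
def length (p : GComp L n) : ℕ := p.blocks.length

/-- The underlying composition `|p|` of `n`. -/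
def abs (p : GComp L n) : Composition n where
  blocks := p.blocks.map Prod.fst
  blocks_pos := by
    intro i hi
    obtain ⟨b, hb, rfl⟩ := List.mem_map.1 hi
    exact p.pos b hb
  blocks_sum := p.sum_eq

/-- The labelled partition `supp(p)` obtained by forgetting the order of the blocks. -/
def supp (p : GComp L n) : GPart L n where
  blocks := (p.blocks : Multiset (ℕ × L))
  pos := by simpa using p.pos
  sum_eq := by simpa using p.sum_eq

/-- The composition `c` of `n` with every block labelled by `g`. -/
def const (g : L) (c : Composition n) : GComp L n where
  blocks := c.blocks.map (fun a => (a, g))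
  pos := by
    intro b hb
    obtain ⟨a, ha, rfl⟩ := List.mem_map.1 hb
    exact c.blocks_pos ha
  sum_eq := by
    rw [List.map_map]
    exact (congrArg List.sum (List.map_id c.blocks)).trans c.blocks_sum

/-- `p ≤ q` iff `q` is a label-preserving refinement of `p`: `q` is the concatenation of lists
of blocks, one list for each block `(a, h)` of `p`, the sizes in it adding up to `a` and all
its labels being equal to `h`. -/
instance : LE (GComp L n) where
  le p q := ∃ parts : List (List (ℕ × L)), parts.flatten = q.blocks ∧
    List.Forall₂ (fun b part => (part.map Prod.fst).sum = b.1 ∧ ∀ x ∈ part, x.2 = b.2)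
      p.blocks parts

instance [Finite L] : Finite (GComp L n) := by
  have : Finite {l : List L // l.length ≤ n} := (List.finite_length_le L n).to_subtype
  refine Finite.of_injective
    (β := Composition n × {l : List L // l.length ≤ n})
    (fun p => (p.abs, ⟨p.blocks.map Prod.snd, ?_⟩)) ?_
  · have h := p.abs.length_le
    simpa [Composition.length, abs] using h
  · intro p q h
    have h1 : p.blocks.map Prod.fst = q.blocks.map Prod.fst :=
      congrArg (fun x => x.1.blocks) h
    have h2 : p.blocks.map Prod.snd = q.blocks.map Prod.snd :=
      congrArg (fun x => x.2.1) h
    refine GComp.ext ?_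
    rw [← List.zip_unzip p.blocks, ← List.zip_unzip q.blocks, List.unzip_eq_map,
      List.unzip_eq_map]
    simp only [h1, h2]

instance [Finite L] : Fintype (GComp L n) := Fintype.ofFinite _

end GComp

/-- Cuts `q` after the shortest initial segment whose sum is at least `a`. -/
def cut : ℕ → List ℕ → List ℕ × List ℕ
  | 0, q => ([], q)
  | _ + 1, [] => ([], [])
  | a + 1, b :: q => (b :: (cut (a + 1 - b) q).1, (cut (a + 1 - b) q).2)

/-- The list `[(q/p)₁, (q/p)₂, …]`, for a refinement `q` of `p`: `(q/p)ᵢ` consists of the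
contiguous blocks of `q` which refine the `i`-th block of `p`. -/
def pieces : List ℕ → List ℕ → List (List ℕ)
  | [], _ => []
  | a :: p, q => (cut a q).1 :: pieces p (cut a q).2

/-- `deg(q/p) = ∏ᵢ ℓ((q/p)ᵢ)`. -/
def deg {n : ℕ} (q p : Composition n) : ℕ :=
  ((pieces p.blocks q.blocks).map List.length).prod

/-- The wreath product `𝔖_n[G]`: `⟨σ, g⟩` stands for `((σ₁, g₁), …, (σ_n, g_n))`. -/
@[ext] structure Wreath (G : Type) (n : ℕ) where
  perm : Equiv.Perm (Fin n)
  col : Fin n → G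

namespace Wreath

variable {G : Type} {n m : ℕ}

/-- `((σᵢ, gᵢ))ᵢ · ((τᵢ, hᵢ))ᵢ = ((σ_{τᵢ}, g_{τᵢ} hᵢ))ᵢ`. -/
instance [Group G] : Group (Wreath G n) where
  mul x y := ⟨x.perm * y.perm, fun i => x.col (y.perm i) * y.col i⟩
  one := ⟨1, fun _ => 1⟩
  inv x := ⟨x.perm⁻¹, fun i => (x.col (x.perm⁻¹ i))⁻¹⟩
  mul_assoc x y z := Wreath.ext (mul_assoc _ _ _) (funext fun _ => mul_assoc _ _ _)
  one_mul x := Wreath.ext (one_mul _) (funext fun _ => one_mul _)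
  mul_one x := Wreath.ext (mul_one _) (funext fun _ => mul_one _)
  inv_mul_cancel x := by
    refine Wreath.ext (inv_mul_cancel _) (funext fun i => ?_)
    change (x.col (x.perm⁻¹ (x.perm i)))⁻¹ * x.col i = 1
    simp

/-- A wreath product element is a permutation together with a colouring. -/
def equivProd : Wreath G n ≃ Equiv.Perm (Fin n) × (Fin n → G) where
  toFun x := (x.perm, x.col)
  invFun x := ⟨x.1, x.2⟩
  left_inv _ := rfl
  right_inv _ := rfl

instance [Fintype G] : Fintype (Wreath G n) := Fintype.ofEquiv _ equivProd.symm

/-- The one-line notation `((σ₁, g₁), …, (σ_n, g_n))`. -/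
def word (x : Wreath G n) : List (Fin n × G) := List.ofFn fun i => (x.perm i, x.col i)

/-- The maximal runs of consecutive letters of `x` along which `σ` increases and the label
stays the same. -/
def runs [DecidableEq G] (x : Wreath G n) : List (List (Fin n × G)) :=
  x.word.splitBy fun a b => decide (a.1 < b.1 ∧ a.2 = b.2)

/-- `co(σ, g)`: the coarsest `G`-composition of `n` along whose blocks `σ` increases and `g` is
constantly equal to the label of the block. Its blocks are the maximal runs of the word, with
their lengths as sizes and the common label as label (runs are non-empty, so that the default
value `1` is never used). -/
def co [Group G] [DecidableEq G] (x : Wreath G n) : GComp G n where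
  blocks := x.runs.map fun r => (r.length, (r.map Prod.snd).headD 1)
  pos := by
    intro b hb
    obtain ⟨r, hr, rfl⟩ := List.mem_map.1 hb
    exact List.length_pos_of_ne_nil (List.ne_nil_of_mem_splitBy hr)
  sum_eq := by
    rw [List.map_map]
    change (x.runs.map List.length).sum = n
    rw [← List.length_flatten, runs, List.flatten_splitBy, word, List.length_ofFn]

/-- `u × v`, through the usual inclusion `𝔖_n[G] × 𝔖_m[G] ↪ 𝔖_{n+m}[G]`: `u` acts on the first `n`
letters and `v` on the last `m` letters. -/
def juxt (u : Wreath G n) (v : Wreath G m) : Wreath G (n + m) where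
  perm := finSumFinEquiv.permCongr (Equiv.sumCongr u.perm v.perm)
  col := Fin.append u.col v.col

/-- The inclusion of `𝔖_n` in `𝔖_n[G]`. -/
def ofPerm [Group G] (w : Equiv.Perm (Fin n)) : Wreath G n := ⟨w, fun _ => 1⟩

end Wreath

open scoped Classical in
/-- `Sh(n, m)`: the `w ∈ 𝔖_{n+m}` with `w₁ < ⋯ < w_n` and `w_{n+1} < ⋯ < w_{n+m}`. -/
def Sh (n m : ℕ) : Finset (Equiv.Perm (Fin (n + m))) :=
  {w | (StrictMono fun i : Fin n => w (Fin.castAdd m i)) ∧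
    StrictMono fun j : Fin m => w (Fin.natAdd n j)}

/-- The group `C₂ = {1, -1}`. -/
abbrev C2 : Type := ℤˣ

/-- The character group of `C₂`; its trivial character is `1`. -/
abbrev C2Dual : Type := C2 →* ℂˣ

/-- The signed permutations `𝔅_n = 𝔖_n[C₂]`. -/
abbrev B (n : ℕ) : Type := Wreath C2 n

/-- The group algebra `ℂ𝔅_n`. -/
abbrev CB (n : ℕ) : Type := MonoidAlgebra ℂ (B n)

open scoped Classical in
/-- `Y_p = ∑_{co(w) = p} w`. -/
def Y {n : ℕ} (p : GComp C2 n) : CB n :=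
  ∑ w : B n with w.co = p, MonoidAlgebra.of ℂ (B n) w

open scoped Classical in
/-- `X_p = ∑_{q ≤ p} Y_q`. -/
def X {n : ℕ} (p : GComp C2 n) : CB n :=
  ∑ q : GComp C2 n with q ≤ p, Y q

/-- `ℂ𝔅 = ⨁_n ℂ𝔅_n`. -/
abbrev CBTotal : Type := ⨁ n : ℕ, CB n

/-- The inclusion of the summand `ℂ𝔅_n` in `ℂ𝔅`. -/
def incl (n : ℕ) : CB n →ₗ[ℂ] CBTotal := DirectSum.lof ℂ ℕ CB n

/-- `u ⋆ v = ∑_{w ∈ Sh(n, m)} w · (u × v)` for signed permutations `u` and `v`. -/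
def starBasis {n m : ℕ} (u : B n) (v : B m) : CB (n + m) :=
  ∑ w ∈ Sh n m, MonoidAlgebra.of ℂ (B (n + m)) (Wreath.ofPerm w * u.juxt v)

/-- The bilinear extension of `⋆` to `ℂ𝔅_n × ℂ𝔅_m → ℂ𝔅`. -/
def starHom (n m : ℕ) : CB n →ₗ[ℂ] CB m →ₗ[ℂ] CBTotal :=
  (MonoidAlgebra.basis (B n) ℂ).constr ℂ fun u =>
    (MonoidAlgebra.basis (B m) ℂ).constr ℂ fun v => incl (n + m) (starBasis u v)

/-- The product `⋆` on `ℂ𝔅`. -/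
def star : CBTotal →ₗ[ℂ] CBTotal →ₗ[ℂ] CBTotal :=
  DirectSum.toModule ℂ ℕ _ fun n =>
    (DirectSum.toModule ℂ ℕ _ fun m => (starHom n m).flip).flip

/-- The unit of `⋆`: the only element of `𝔅_0`. -/
def starOne : CBTotal := incl 0 1

/-- `∑_{c ∈ Γ_n} (-1)^{ℓ(c)-1} / ℓ(c) · X_{c^g}`, where `c^g` has all its labels equal to `g`.
For `g = 1` this is the Reutenauer idempotent `r_n`, for `g = -1` it is `r̄_n`. -/
def reut (g : C2) (n : ℕ) : CB n :=
  ∑ c : Composition n, ((-1 : ℂ) ^ (c.length - 1) / (c.length : ℂ)) • X (GComp.const g c)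

open scoped Classical in
/-- `𝓘_n = ½ (r_n + r̄_n)` for the trivial character, `𝓘_n̄ = ½ (r_n - r̄_n)` for the sign
character. -/
def I1 (b : ℕ × C2Dual) : CBTotal :=
  incl b.1 (if b.2 = 1 then (1 / 2 : ℂ) • (reut 1 b.1 + reut (-1) b.1)
    else (1 / 2 : ℂ) • (reut 1 b.1 - reut (-1) b.1))

/-- `𝓘_α = 𝓘_{α₁} ⋆ 𝓘_{α₂} ⋆ ⋯ ⋆ 𝓘_{α_k}`. -/
def I {n : ℕ} (α : GComp C2Dual n) : CBTotal :=
  α.blocks.foldr (fun b x => star (I1 b) x) starOne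

open scoped Classical in
/-- Vazirani's idempotent `𝔤_λ = 1/ℓ(λ)! ∑_{supp(α) = λ} 𝓘_α`. -/
def vazirani {n : ℕ} (lam : GPart C2Dual n) : CBTotal :=
  (1 / (lam.length.factorial : ℂ)) • ∑ α : GComp C2Dual n with α.supp = lam, I α

/-- The evaluation `α(p) = α₁(p₁) α₂(p₂) ⋯`, for `|p| = |α|`. -/
def eval {n : ℕ} (α : GComp C2Dual n) (p : GComp C2 n) : ℂ :=
  (List.zipWith (fun a b => ((a.2 b.2 : ℂˣ) : ℂ)) α.blocks p.blocks).prod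

end MR

end

noncomputable section

/-! The condition `co w ≤ p` is local: it says that on each block of `p` the word of `w` increases
and carries the block's label. So `X p` is the sum of all such `w` (`co_le_iff`, `X_eq_sum`). Each
signed permutation of `m + n` letters is uniquely a shuffle times some `u × v`, and a shuffle keeps
the order inside both halves. Hence `X p ⋆ X q = X (p.append q)` (`star_X`). Multiplying the
elements `reut h a` over the blocks of `p` therefore amounts to choosing a composition of each
block, that is, a refinement `q` of `p`. The signs multiply to `(-1)^(ℓ(q) - ℓ(p))` and the
denominators to `deg(q/p)` (`reutProd_eq`). Finally `I1 (a, χ)` is the Fourier average of the `reut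
h a` against `χ` (`I1_eq`). By multilinearity `I α` is a sum over the labellings `p` of the
composition `|α|` (`I_eq`), and the corollary sums this over `α`. -/

namespace MR

/-! ### Words cut by labelled compositions -/

section Matches

variable {β γ : Type} {G : Type} [LinearOrder β] [LinearOrder γ]

/-- `Matches p w`: the word `w` is cut by the labelled composition `p` into blocks along which the
letters increase and the colour equals the label of the block. -/
def Matches : List (ℕ × G) → List (β × G) → Prop
  | [], w => w = []
  | b :: p, w => b.1 ≤ w.length ∧ (w.take b.1).IsChain (fun x y => x.1 < y.1 ∧ x.2 = y.2) ∧
      (∀ x ∈ w.take b.1, x.2 = b.2) ∧ Matches p (w.drop b.1)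

theorem matches_append {p q : List (ℕ × G)} {A B : List (β × G)}
    (h : A.length = (p.map Prod.fst).sum) :
    Matches (p ++ q) (A ++ B) ↔ Matches p A ∧ Matches q B := by
  induction p generalizing A with
  | nil =>
    obtain rfl : A = [] := by simpa using h
    simp [Matches]
  | cons b p ih =>
    have hb : b.1 ≤ A.length := by simp at h; omega
    have h' : (A.drop b.1).length = (p.map Prod.fst).sum := by simp at h ⊢; omega
    simp only [List.cons_append, Matches, List.take_append_of_le_length hb,
      List.drop_append_of_le_length hb, ih h', List.length_append]
    have : b.1 ≤ A.length + B.length := by omega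
    tauto

theorem matches_map {f : β → γ} (hf : ∀ a b, f a < f b ↔ a < b) {p : List (ℕ × G)}
    {w : List (β × G)} : Matches p (w.map fun x => (f x.1, x.2)) ↔ Matches p w := by
  induction p generalizing w with
  | nil => simp [Matches]
  | cons b p ih =>
    simp only [Matches, ← List.map_drop, ← List.map_take, ih, List.length_map,
      List.isChain_map, hf, List.forall_mem_map]

theorem matches_of_isChain {p : List (ℕ × G)} {w : List (β × G)} {g : G}
    (hw : w.IsChain (fun x y => x.1 < y.1 ∧ x.2 = y.2)) (hg : ∀ x ∈ w, x.2 = g)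
    (hp : (p.map Prod.fst).sum = w.length) (hpg : ∀ b ∈ p, b.2 = g) : Matches p w := by
  induction p generalizing w with
  | nil =>
    have : w.length = 0 := by simpa using hp.symm
    simpa [Matches] using this
  | cons b p ih =>
    simp only [List.map_cons, List.sum_cons] at hp
    refine ⟨by omega, hw.take _, fun x hx => ?_, ih (hw.drop _) ?_ ?_ ?_⟩
    · rw [hg x (List.mem_of_mem_take hx), hpg b (by simp)]
    · exact fun x hx => hg x (List.mem_of_mem_drop hx)
    · rw [List.length_drop]; omega
    · exact fun c hc => hpg c (by simp [hc])

theorem snd_eq_of_isChain {w : List (β × G)} {x : β × G}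
    (hw : (x :: w).IsChain (fun x y => x.1 < y.1 ∧ x.2 = y.2)) : ∀ y ∈ x :: w, y.2 = x.2 := by
  induction w generalizing x with
  | nil => simp
  | cons z w ih =>
    rw [List.isChain_cons_cons] at hw
    intro y hy
    rcases List.mem_cons.1 hy with rfl | hy
    · rfl
    · rw [ih hw.2 y hy, hw.1.2]

/-- The block of a run: its length and its colour. -/
def runBlock [One G] (r : List (β × G)) : ℕ × G := (r.length, (r.map Prod.snd).headD 1)

/-- The relation between a block and the list of blocks refining it. -/
def Refines (b : ℕ × G) (part : List (ℕ × G)) : Prop :=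
  (part.map Prod.fst).sum = b.1 ∧ ∀ x ∈ part, x.2 = b.2

theorem matches_flatten [One G] {runs : List (List (β × G))} {parts : List (List (ℕ × G))}
    (hr : ∀ r ∈ runs, r.IsChain (fun x y => x.1 < y.1 ∧ x.2 = y.2))
    (h : List.Forall₂ Refines (runs.map runBlock) parts) :
    Matches parts.flatten runs.flatten := by
  induction runs generalizing parts with
  | nil =>
    cases h
    simp [Matches]
  | cons r runs ih =>
    rw [List.map_cons, List.forall₂_cons_left_iff] at h
    obtain ⟨part, parts, ⟨h1, h2⟩, h, rfl⟩ := h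
    rw [List.flatten_cons, List.flatten_cons, matches_append h1.symm]
    refine ⟨matches_of_isChain (g := (runBlock r).2) (hr r (by simp)) ?_ h1 h2,
      ih (fun s hs => hr s (by simp [hs])) h⟩
    have := hr r (by simp)
    cases r with
    | nil => simp
    | cons x r => exact snd_eq_of_isChain this

/-- A block of `p` never straddles two maximal runs, so the blocks group by the run containing them.
By induction, the first block either is a run by itself or extends the first run of the remaining
word. -/
theorem exists_refines_of_matches [One G] [DecidableEq G] {p : List (ℕ × G)} {w : List (β × G)}
    (hp : ∀ b ∈ p, 0 < b.1) (h : Matches p w) :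
    ∃ parts : List (List (ℕ × G)), parts.flatten = p ∧ List.Forall₂ Refines
      ((w.splitBy fun a b => decide (a.1 < b.1 ∧ a.2 = b.2)).map runBlock) parts := by
  induction p generalizing w with
  | nil =>
    obtain rfl : w = [] := h
    exact ⟨[], by simp⟩
  | cons b p ih =>
    obtain ⟨hb, hc, hl, h⟩ := h
    obtain ⟨parts, rfl, hparts⟩ := ih (fun c hc => hp c (by simp [hc])) h
    have hb0 := hp b (by simp)
    set A := w.take b.1 with hA
    set D := w.drop b.1 with hD
    have hAl : A.length = b.1 := by simp [hA, hb]
    have hw : w = A ++ D := (List.take_append_drop b.1 w).symm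
    -- Blocks have positive size, so `A` has a first letter and the default label in `runBlock`
    -- never appears.
    have hA0 : A ≠ [] := List.ne_nil_of_length_pos (by omega)
    have hAb : ∀ B : List (β × G), runBlock (A ++ B) = (b.1 + B.length, b.2) := by
      intro B
      obtain ⟨x, A', hx⟩ := List.exists_cons_of_ne_nil hA0
      rw [hx] at hAl hl ⊢
      simp only [runBlock, ← hAl, List.length_append, Prod.mk.injEq, true_and]
      exact hl x (by simp)
    -- Does a run end at the junction of `A` and `D`? If so, `[b]` refines the run `A`; otherwise
    -- `A` fuses with the first run `r` of `D`, and `b` joins the part refining `r`.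
    by_cases hj : ∀ x ∈ A.getLast?, ∀ y ∈ D.head?, (decide (x.1 < y.1 ∧ x.2 = y.2)) = false
    · refine ⟨[b] :: parts, by simp, ?_⟩
      rw [hw, List.splitBy_append hj, List.splitBy_of_isChain hA0 (by simpa using hc)]
      refine List.Forall₂.cons ?_ hparts
      have := hAb []
      rw [List.append_nil] at this
      simp [this, Refines]
    · push Not at hj
      obtain ⟨x, hx, y, hy, hxy⟩ := hj
      replace hxy : x.1 < y.1 ∧ x.2 = y.2 := by simpa using hxy
      have hD0 : D ≠ [] := by rintro h; simp [h] at hy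
      set S := D.splitBy fun a b => decide (a.1 < b.1 ∧ a.2 = b.2) with hS
      obtain ⟨h1, h2, h3, h4⟩ := List.splitBy_eq_iff.1 hS.symm
      obtain ⟨r, rs, hrs⟩ := List.exists_cons_of_ne_nil (List.splitBy_ne_nil.2 hD0 : S ≠ [])
      change S = r :: rs at hrs
      rw [hrs] at hparts h1 h2 h3 h4
      rw [List.map_cons, List.forall₂_cons_left_iff] at hparts
      obtain ⟨part, parts, ⟨hp1, hp2⟩, hparts, rfl⟩ := hparts
      have hr0 : r ≠ [] := by rintro rfl; simp at h2
      have hyr : y ∈ r.head? := by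
        rw [h1, List.flatten_cons, List.head?_append_of_ne_nil _ hr0] at hy
        exact hy
      refine ⟨(b :: part) :: parts, by simp, ?_⟩
      have key : (w.splitBy fun a b => decide (a.1 < b.1 ∧ a.2 = b.2)) = (A ++ r) :: rs := by
        rw [List.splitBy_eq_iff]
        refine ⟨by rw [hw, h1]; simp, ?_, ?_, ?_⟩
        · simp only [List.mem_cons, not_or] at h2 ⊢
          exact ⟨by simpa using fun h => absurd h hA0, h2.2⟩
        · intro m hm
          rcases List.mem_cons.1 hm with rfl | hm
          · refine List.isChain_append.2 ⟨by simpa using hc, h3 r (by simp), ?_⟩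
            intro x' hx' y' hy'
            obtain rfl := Option.mem_unique hx hx'
            obtain rfl := Option.mem_unique hyr hy'
            simpa using hxy
          · exact h3 m (by simp [hm])
        · cases rs with
          | nil => simp
          | cons s rs =>
            rw [List.isChain_cons_cons] at h4 ⊢
            refine ⟨?_, h4.2⟩
            obtain ⟨ha, hb, hab⟩ := h4.1
            exact ⟨by simp [ha], hb, by rwa [List.getLast_append_of_ne_nil _ ha]⟩
      rw [key]
      refine List.Forall₂.cons ?_ hparts
      obtain ⟨y', r', rfl⟩ := List.exists_cons_of_ne_nil hr0
      obtain rfl : y' = y := by simpa using hyr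
      -- The colour does not change across the junction, so `r` has the label of `b`.
      have hxb : y'.2 = b.2 := by
        rw [← hxy.2]
        exact hl x (List.mem_of_getLast? hx)
      rw [hAb]
      simp only [runBlock] at hp1 hp2
      refine ⟨by simp only [List.map_cons, List.sum_cons, hp1], ?_⟩
      intro z hz
      rcases List.mem_cons.1 hz with rfl | hz
      · rfl
      · rw [hp2 z hz]
        exact hxb

end Matches

/-! ### The elements `X p` as sums of signed permutations -/

theorem co_le_iff {n : ℕ} (w : B n) (p : GComp C2 n) : w.co ≤ p ↔ Matches p.blocks w.word := by
  constructor
  · rintro ⟨parts, h1, h2⟩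
    rw [← h1, ← List.flatten_splitBy (fun a b => decide (a.1 < b.1 ∧ a.2 = b.2)) w.word]
    refine matches_flatten (fun r hr => ?_) h2
    simpa using List.isChain_of_mem_splitBy hr
  · intro h
    exact exists_refines_of_matches p.pos h

open scoped Classical in
theorem X_eq_sum {n : ℕ} (p : GComp C2 n) :
    X p = ∑ w : B n with w.co ≤ p, MonoidAlgebra.of ℂ (B n) w := by
  rw [X, ← Finset.sum_fiberwise_of_maps_to (t := {q : GComp C2 n | q ≤ p}) (g := Wreath.co)
    (by simp)]
  refine Finset.sum_congr rfl fun q hq => ?_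
  rw [Y]
  refine Finset.sum_congr ?_ fun _ _ => rfl
  ext w
  simp only [Finset.mem_filter, Finset.mem_univ, true_and] at hq ⊢
  constructor
  · rintro rfl; exact ⟨hq, rfl⟩
  · exact And.right

/-! ### Shuffles and the product `⋆` of two elements `X` -/

/-- Concatenation of labelled compositions. -/
def GComp.append {L : Type} {m n : ℕ} (p : GComp L m) (q : GComp L n) : GComp L (m + n) where
  blocks := p.blocks ++ q.blocks
  pos b hb := (List.mem_append.1 hb).elim (p.pos b) (q.pos b)
  sum_eq := by rw [List.map_append, List.sum_append, p.sum_eq, q.sum_eq]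

theorem word_shuffle {m n : ℕ} (s : Equiv.Perm (Fin (m + n))) (u : B m) (v : B n) :
    (Wreath.ofPerm s * u.juxt v : B (m + n)).word =
      (u.word.map fun x => (s (Fin.castAdd n x.1), x.2)) ++
        v.word.map fun x => (s (Fin.natAdd m x.1), x.2) := by
  simp only [Wreath.word, List.map_ofFn, ← List.ofFn_fin_append]
  congr 1
  funext i
  change (s _, (1 : C2) * _) = _
  rw [one_mul]
  refine Fin.addCases (fun i => ?_) (fun i => ?_) i
  · simp [Wreath.juxt]
  · simp [Wreath.juxt]

/-- No block of the concatenation crosses from the first half to the second, and `s` is increasing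
on each half, so the order of letters inside a block is unchanged. -/
theorem co_shuffle_le_iff {m n : ℕ} {s : Equiv.Perm (Fin (m + n))} (hs : s ∈ Sh m n) (u : B m)
    (v : B n) (p : GComp C2 m) (q : GComp C2 n) :
    (Wreath.ofPerm s * u.juxt v : B (m + n)).co ≤ p.append q ↔ u.co ≤ p ∧ v.co ≤ q := by
  simp only [Sh, Finset.mem_filter, Finset.mem_univ, true_and] at hs
  rw [co_le_iff, co_le_iff, co_le_iff, word_shuffle]
  change Matches (p.blocks ++ q.blocks) _ ↔ _
  rw [matches_append (by simp [Wreath.word, p.sum_eq]),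
    matches_map (f := fun i => s (Fin.castAdd n i)) (fun a b => hs.1.lt_iff_lt),
    matches_map (f := fun i => s (Fin.natAdd m i)) (fun a b => hs.2.lt_iff_lt)]

/-- A strictly increasing map is determined by its range, and precomposing with a permutation does
not alter the range. -/
theorem strictMono_comp_perm_inj {n : ℕ} {α : Type} [LinearOrder α] {f f' : Fin n → α}
    (hf : StrictMono f) (hf' : StrictMono f') {u u' : Equiv.Perm (Fin n)}
    (h : f ∘ u = f' ∘ u') : f = f' ∧ u = u' := by
  have hr : Set.range f = Set.range f' := by
    rw [← u.surjective.range_comp f, h, u'.surjective.range_comp]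
  have hff := (StrictMono.range_inj hf hf').1 hr
  subst hff
  exact ⟨rfl, Equiv.ext fun i => hf.injective (congrFun h i)⟩

theorem shuffle_injective {m n : ℕ} {s s' : Equiv.Perm (Fin (m + n))} (hs : s ∈ Sh m n)
    (hs' : s' ∈ Sh m n) {u u' : B m} {v v' : B n}
    (h : (Wreath.ofPerm s * u.juxt v : B (m + n)) = Wreath.ofPerm s' * u'.juxt v') :
    s = s' ∧ u = u' ∧ v = v' := by
  simp only [Sh, Finset.mem_filter, Finset.mem_univ, true_and] at hs hs'
  have hw := congrArg Wreath.word h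
  rw [word_shuffle, word_shuffle] at hw
  obtain ⟨h1, h2⟩ := List.append_inj hw (by simp [Wreath.word])
  simp only [Wreath.word, List.map_ofFn, List.ofFn_inj] at h1 h2
  obtain ⟨f1, g1⟩ := strictMono_comp_perm_inj hs.1 hs'.1 (u := u.perm) (u' := u'.perm)
    (funext fun i => congrArg Prod.fst (congrFun h1 i))
  obtain ⟨f2, g2⟩ := strictMono_comp_perm_inj hs.2 hs'.2 (u := v.perm) (u' := v'.perm)
    (funext fun i => congrArg Prod.fst (congrFun h2 i))
  refine ⟨Equiv.ext fun i => ?_, Wreath.ext g1 ?_, Wreath.ext g2 ?_⟩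
  · exact Fin.addCases (fun i => congrFun f1 i) (fun i => congrFun f2 i) i
  · exact funext fun i => congrArg Prod.snd (congrFun h1 i)
  · exact funext fun i => congrArg Prod.snd (congrFun h2 i)

theorem exists_shuffle {m n : ℕ} (w : B (m + n)) :
    ∃ s ∈ Sh m n, ∃ (u : B m) (v : B n), Wreath.ofPerm s * u.juxt v = w := by
  set f : Fin m → Fin (m + n) := fun i => w.perm (Fin.castAdd n i) with hf
  set g : Fin n → Fin (m + n) := fun i => w.perm (Fin.natAdd m i) with hg
  have hfi : Function.Injective f := w.perm.injective.comp (Fin.castAdd_injective m n)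
  have hgi : Function.Injective g := w.perm.injective.comp (Fin.natAdd_injective n m)
  -- `u` and `v` are the standardizations of the two halves of `w`; the remaining factor then lists
  -- the values of each half in increasing order.
  let u : B m := ⟨(Tuple.sort f)⁻¹, fun i => w.col (Fin.castAdd n i)⟩
  let v : B n := ⟨(Tuple.sort g)⁻¹, fun i => w.col (Fin.natAdd m i)⟩
  refine ⟨w.perm * ((Wreath.juxt u v).perm)⁻¹, ?_, u, v, ?_⟩
  · have h1 : ∀ i, (w.perm * ((Wreath.juxt u v).perm)⁻¹) (Fin.castAdd n i) =
        f (Tuple.sort f i) := by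
      intro i
      rw [Equiv.Perm.mul_apply]
      refine congrArg w.perm ?_
      rw [Equiv.Perm.inv_eq_iff_eq]
      simp [Wreath.juxt, u]
    have h2 : ∀ i, (w.perm * ((Wreath.juxt u v).perm)⁻¹) (Fin.natAdd m i) =
        g (Tuple.sort g i) := by
      intro i
      rw [Equiv.Perm.mul_apply]
      refine congrArg w.perm ?_
      rw [Equiv.Perm.inv_eq_iff_eq]
      simp [Wreath.juxt, v]
    simp only [Sh, Finset.mem_filter, Finset.mem_univ, true_and, h1, h2]
    exact ⟨(Tuple.monotone_sort f).strictMono_of_injective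
        (hfi.comp (Tuple.sort f).injective),
      (Tuple.monotone_sort g).strictMono_of_injective (hgi.comp (Tuple.sort g).injective)⟩
  · refine Wreath.ext ?_ (funext fun i => ?_)
    · exact inv_mul_cancel_right _ _
    · change (1 : C2) * Fin.append _ _ i = _
      rw [one_mul]
      refine Fin.addCases (fun i => ?_) (fun i => ?_) i
      · simp [u]
      · simp [v]

theorem star_incl {m n : ℕ} (x : CB m) (y : CB n) :
    star (incl m x) (incl n y) = starHom m n x y := by
  simp only [star, incl, DirectSum.toModule_lof, LinearMap.flip_apply]

theorem starHom_of {m n : ℕ} (u : B m) (v : B n) :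
    starHom m n (MonoidAlgebra.of ℂ (B m) u) (MonoidAlgebra.of ℂ (B n) v) =
      incl (m + n) (starBasis u v) := by
  have hu : MonoidAlgebra.of ℂ (B m) u = MonoidAlgebra.basis (B m) ℂ u := by
    rw [MonoidAlgebra.basis_apply]; rfl
  have hv : MonoidAlgebra.of ℂ (B n) v = MonoidAlgebra.basis (B n) ℂ v := by
    rw [MonoidAlgebra.basis_apply]; rfl
  rw [starHom, hu, hv, Module.Basis.constr_basis, Module.Basis.constr_basis]

open scoped Classical in
theorem star_X {m n : ℕ} (p : GComp C2 m) (q : GComp C2 n) :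
    star (incl m (X p)) (incl n (X q)) = incl (m + n) (X (p.append q)) := by
  rw [star_incl, X_eq_sum, X_eq_sum, X_eq_sum]
  simp only [map_sum, LinearMap.sum_apply, starHom_of, starBasis]
  simp only [← map_sum]
  congr 1
  rw [Finset.sum_comm, ← Finset.sum_product', ← Finset.sum_product']
  -- Unique factorization through shuffles, with the conditions on `u` and `v` carried along by
  -- `co_shuffle_le_iff`.
  refine Finset.sum_nbij (fun x => Wreath.ofPerm x.2 * x.1.1.juxt x.1.2) ?_ ?_ ?_ ?_
  · rintro ⟨⟨u, v⟩, s⟩ h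
    simp only [Finset.mem_product, Finset.mem_filter, Finset.mem_univ, true_and] at h ⊢
    exact (co_shuffle_le_iff h.2 u v p q).2 h.1
  · rintro ⟨⟨u, v⟩, s⟩ h ⟨⟨u', v'⟩, s'⟩ h' he
    simp only [Finset.coe_product, Set.mem_prod, Finset.mem_coe] at h h'
    obtain ⟨rfl, rfl, rfl⟩ := shuffle_injective h.2 h'.2 he
    rfl
  · intro w hw
    obtain ⟨s, hs, u, v, rfl⟩ := exists_shuffle w
    refine ⟨⟨⟨u, v⟩, s⟩, ?_, rfl⟩
    simp only [Finset.coe_filter, Finset.mem_univ, true_and, Set.mem_ofPred_eq] at hw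
    simpa [hs] using (co_shuffle_le_iff hs u v p q).1 hw
  · exact fun _ _ => rfl

/-! ### Refinements block by block and their coefficients -/

namespace GComp

variable {L : Type} {n : ℕ}

/-- The empty labelled composition. -/
def nil : GComp L 0 := ⟨[], by simp, by simp⟩

/-- Adds a block in front of a labelled composition. -/
def cons (b : ℕ × L) (hb : 0 < b.1) (p : GComp L n) : GComp L (b.1 + n) :=
  ⟨b :: p.blocks, by simpa using ⟨hb, fun a l => p.pos (a, l)⟩, by simp [p.sum_eq]⟩

theorem cons_induction {motive : ∀ n, GComp L n → Prop} (h0 : motive 0 nil)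
    (hcons : ∀ n b hb p, motive n p → motive (b.1 + n) (cons b hb p)) {n : ℕ} (p : GComp L n) :
    motive n p := by
  obtain ⟨l, hl, hs⟩ := p
  induction l generalizing n with
  | nil =>
    subst hs
    exact h0
  | cons b l ih =>
    subst hs
    exact hcons _ b (hl b (by simp)) _ (ih (fun c hc => hl c (by simp [hc])) rfl)

theorem eq_nil (p : GComp L 0) : p = nil := by
  refine GComp.ext ?_
  obtain ⟨l, hl, hs⟩ := p
  cases l with
  | nil => rfl
  | cons b l =>
    have := hl b (by simp)
    simp at hs
    omega

theorem le_nil {p : GComp L 0} : nil ≤ p := by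
  rw [eq_nil p]
  exact ⟨[], by simp [nil]⟩

theorem cons_le_iff {b : ℕ × L} {hb : 0 < b.1} {p : GComp L n} {q : GComp L (b.1 + n)} :
    cons b hb p ≤ q ↔ ∃ (c : Composition b.1) (q' : GComp L n), p ≤ q' ∧
      (const b.2 c).append q' = q := by
  constructor
  · rintro ⟨parts, h1, h2⟩
    change List.Forall₂ _ (b :: p.blocks) _ at h2
    rw [List.forall₂_cons_left_iff] at h2
    obtain ⟨part, parts, ⟨h3, h4⟩, h2, rfl⟩ := h2
    have hpos := q.pos
    have hsum := q.sum_eq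
    rw [← h1, List.flatten_cons] at hpos hsum
    refine ⟨⟨part.map Prod.fst, ?_, h3⟩, ⟨parts.flatten, ?_, ?_⟩, ⟨parts, rfl, h2⟩, ?_⟩
    · intro i hi
      obtain ⟨x, hx, rfl⟩ := List.mem_map.1 hi
      exact hpos x (List.mem_append_left _ hx)
    · exact fun c hc => hpos c (List.mem_append_right _ hc)
    · rw [List.map_append, List.sum_append, h3] at hsum
      omega
    · refine GComp.ext (Eq.trans ?_ h1)
      change List.map _ (List.map _ part) ++ _ = _
      rw [List.flatten_cons, List.map_map]
      congr 1
      refine (List.map_congr_left fun x hx => ?_).trans (List.map_id _)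
      simp [← h4 x hx]
  · rintro ⟨c, q', ⟨parts, h1, h2⟩, rfl⟩
    refine ⟨(const b.2 c).blocks :: parts, by rw [List.flatten_cons, h1]; rfl, ?_⟩
    refine List.Forall₂.cons ⟨(const b.2 c).sum_eq, ?_⟩ h2
    simp [const]

end GComp

/-- Positivity matters: `cut` stops as soon as the target is reached, so it would leave behind
trailing zeros of `l`. -/
theorem cut_append {l : List ℕ} (hl : ∀ a ∈ l, 0 < a) (l' : List ℕ) :
    cut l.sum (l ++ l') = (l, l') := by
  induction l with
  | nil => simp [cut]
  | cons a l ih =>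
    obtain ⟨k, hk⟩ : ∃ k, (a :: l).sum = k + 1 :=
      ⟨(a :: l).sum - 1, by have := hl a (by simp); simp; omega⟩
    rw [hk, List.cons_append, cut]
    have : k + 1 - a = l.sum := by rw [← hk]; simp
    rw [this, ih fun b hb => hl b (by simp [hb])]

theorem abs_append_blocks {L : Type} {m n : ℕ} (g : L) (c : Composition m) (q : GComp L n) :
    ((GComp.const g c).append q).abs.blocks = c.blocks ++ q.abs.blocks := by
  change List.map Prod.fst (List.map (fun a => (a, g)) c.blocks ++ q.blocks) = _
  simp [List.map_map, Function.comp_def, GComp.abs]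

/-- Cutting the sizes at `m` recovers the first factor. -/
theorem const_append_injective {L : Type} {m n : ℕ} {g : L} {c c' : Composition m}
    {q q' : GComp L n} (h : (GComp.const g c).append q = (GComp.const g c').append q') :
    c = c' ∧ q = q' := by
  have hb := congrArg (fun p => cut m p.abs.blocks) h
  simp only [abs_append_blocks] at hb
  have hc := cut_append (fun _ => c.blocks_pos) q.abs.blocks
  have hc' := cut_append (fun _ => c'.blocks_pos) q'.abs.blocks
  rw [c.blocks_sum] at hc
  rw [c'.blocks_sum] at hc'
  rw [hc, hc', Prod.mk.injEq] at hb
  obtain rfl := Composition.ext hb.1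
  refine ⟨rfl, GComp.ext ?_⟩
  exact List.append_cancel_left (congrArg GComp.blocks h)

theorem deg_cons {L : Type} {n : ℕ} {b : ℕ × L} (hb : 0 < b.1) (p q : GComp L n)
    (c : Composition b.1) :
    deg ((GComp.const b.2 c).append q).abs (GComp.cons b hb p).abs =
      c.length * deg q.abs p.abs := by
  have hc := cut_append (fun _ => c.blocks_pos) q.abs.blocks
  rw [c.blocks_sum] at hc
  rw [deg, abs_append_blocks]
  change ((pieces (b.1 :: p.abs.blocks) _).map _).prod = _
  rw [pieces, hc]
  simp [deg, Composition.length]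

theorem GComp.length_le_of_le {L : Type} {n : ℕ} {p q : GComp L n} (h : p ≤ q) :
    p.length ≤ q.length := by
  induction p using GComp.cons_induction with
  | h0 => exact Nat.zero_le _
  | hcons n b hb p ih =>
    obtain ⟨c, q', h', rfl⟩ := GComp.cons_le_iff.1 h
    have := ih h'
    have hc : 0 < c.length := c.length_pos_of_pos hb
    simp only [GComp.length, GComp.cons, GComp.append, GComp.const, List.length_cons,
      List.length_append, List.length_map, Composition.length] at *
    omega

/-- The coefficient `(-1)^(ℓ(q) - ℓ(p)) / deg(q/p)`. -/
def refCoeff {L : Type} {n : ℕ} (p q : GComp L n) : ℂ :=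
  (-1 : ℂ) ^ (q.length - p.length) / (deg q.abs p.abs : ℂ)

theorem refCoeff_cons {L : Type} {n : ℕ} {b : ℕ × L} (hb : 0 < b.1) {p q : GComp L n}
    (h : p ≤ q) (c : Composition b.1) :
    refCoeff (GComp.cons b hb p) ((GComp.const b.2 c).append q) =
      (-1 : ℂ) ^ (c.length - 1) / (c.length : ℂ) * refCoeff p q := by
  have hl := GComp.length_le_of_le h
  have hc : 0 < c.length := c.length_pos_of_pos hb
  -- The truncated subtractions are genuine because `ℓ(p) ≤ ℓ(q)` and `c` is nonempty.
  have h1 : ((GComp.const b.2 c).append q).length - (GComp.cons b hb p).length =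
      (c.length - 1) + (q.length - p.length) := by
    simp only [GComp.length, GComp.cons, GComp.append, GComp.const, List.length_cons,
      List.length_append, List.length_map, Composition.length] at *
    omega
  rw [refCoeff, refCoeff, h1, deg_cons, pow_add, Nat.cast_mul, div_mul_div_comm]

/-! ### Products of Reutenauer elements -/

/-- The `⋆`-product of the elements `r_a` and `r̄_a` over a list of blocks. -/
def reutProd (l : List (ℕ × C2)) : CBTotal :=
  l.foldr (fun b x => star (incl b.1 (reut b.2 b.1)) x) starOne

theorem X_nil : X (GComp.nil : GComp C2 0) = 1 := by
  classical
  have h1 : ∀ w : B 0, w = 1 := fun w =>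
    Wreath.ext (Subsingleton.elim _ _) (Subsingleton.elim _ _)
  rw [X_eq_sum, Finset.filter_true_of_mem, Finset.sum_eq_single (1 : B 0), map_one]
  · exact fun w _ hw => absurd (h1 w) hw
  · simp
  · intro w _
    rw [GComp.eq_nil w.co]
    exact GComp.le_nil

open scoped Classical in
theorem reutProd_eq {n : ℕ} (p : GComp C2 n) :
    reutProd p.blocks = incl n (∑ q : GComp C2 n with p ≤ q, refCoeff p q • X q) := by
  induction p using GComp.cons_induction with
  | h0 =>
    have : (Finset.univ.filter fun q : GComp C2 0 => GComp.nil ≤ q) = {GComp.nil} := by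
      ext q
      simp [GComp.eq_nil q, GComp.le_nil]
    rw [this, Finset.sum_singleton, X_nil]
    simp [refCoeff, deg, GComp.abs, GComp.nil, pieces, GComp.length, reutProd, starOne]
  | hcons n b hb p ih =>
    have h1 : reutProd (GComp.cons b hb p).blocks =
        star (incl b.1 (reut b.2 b.1)) (reutProd p.blocks) := rfl
    rw [h1, ih, reut]
    simp only [map_sum, LinearMap.sum_apply, map_smul, LinearMap.smul_apply, star_X]
    simp only [Finset.smul_sum]
    rw [Finset.sum_comm, ← Finset.sum_product']
    -- A refinement of `cons b hb p` is uniquely a composition of `b.1` followed by a refinement of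
    -- `p`.
    refine Finset.sum_nbij (fun x => (GComp.const b.2 x.1).append x.2) ?_ ?_ ?_ ?_
    · rintro ⟨c, q⟩ h
      simp only [Finset.mem_product, Finset.mem_filter, Finset.mem_univ, true_and] at h ⊢
      exact GComp.cons_le_iff.2 ⟨c, q, h, rfl⟩
    · rintro ⟨c, q⟩ h ⟨c', q'⟩ h' he
      obtain ⟨rfl, rfl⟩ := const_append_injective he
      rfl
    · intro q hq
      simp only [Finset.coe_filter, Finset.mem_univ, true_and, Set.mem_ofPred_eq] at hq
      obtain ⟨c, q', h, rfl⟩ := GComp.cons_le_iff.1 hq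
      exact ⟨(c, q'), by simpa using h, rfl⟩
    · rintro ⟨c, q⟩ h
      simp only [Finset.mem_product, Finset.mem_filter, Finset.mem_univ, true_and] at h
      simp only [refCoeff_cons hb h, smul_smul]
      rw [mul_comm]

/-! ### Characters and the expansion of `I α` -/

theorem char_eq_or (χ : C2Dual) (h : C2) : ((χ h : ℂˣ) : ℂ) = 1 ∨ ((χ h : ℂˣ) : ℂ) = -1 := by
  rw [← mul_self_eq_one_iff, ← Units.val_mul, ← map_mul, Int.units_mul_self, map_one,
    Units.val_one]

theorem conj_char (χ : C2Dual) (h : C2) :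
    (starRingEnd ℂ) ((χ h : ℂˣ) : ℂ) = ((χ h : ℂˣ) : ℂ) := by
  rcases char_eq_or χ h with h | h <;> simp [h]

theorem I1_eq (b : ℕ × C2Dual) :
    I1 b = (1 / 2 : ℂ) • ∑ h : C2, (starRingEnd ℂ) ((b.2 h : ℂˣ) : ℂ) • incl b.1 (reut h b.1) := by
  have hs : (Finset.univ : Finset C2) = {1, -1} := rfl
  rw [hs, Finset.sum_pair (by decide)]
  simp only [conj_char, map_one, Units.val_one, one_smul]
  by_cases hb : b.2 = 1
  · simp [I1, hb]
  -- A character with value `1` at `-1` is trivial, so the `else` branch of `I1` is exactly the sign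
  -- character.
  · have h3 : ((b.2 (-1) : ℂˣ) : ℂ) = -1 := by
      refine (char_eq_or b.2 (-1)).resolve_left fun h => hb (MonoidHom.ext fun u => ?_)
      rcases Int.units_eq_one_or u with rfl | rfl
      · simp
      · exact Units.ext h
    rw [I1, if_neg hb, h3]
    rw [map_smul, sub_eq_add_neg, map_add, ← neg_one_smul ℂ (reut (-1) b.1), map_smul]

open scoped Classical in
theorem I_eq {n : ℕ} (α : GComp C2Dual n) :
    I α = (1 / 2 : ℂ) ^ α.length • ∑ p : GComp C2 n with p.abs = α.abs,
      (starRingEnd ℂ) (eval α p) • reutProd p.blocks := by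
  induction α using GComp.cons_induction with
  | h0 =>
    have : (Finset.univ.filter fun p : GComp C2 0 => p.abs = (GComp.nil : GComp C2Dual 0).abs) =
        {GComp.nil} := by
      ext q
      simp [GComp.eq_nil q, GComp.abs, GComp.nil]
    rw [this, Finset.sum_singleton]
    simp [GComp.nil, I, GComp.length, eval, reutProd]
  | hcons n b hb α ih =>
    have h1 : I (GComp.cons b hb α) = star (I1 b) (I α) := rfl
    rw [h1, ih, I1_eq]
    simp only [map_sum, LinearMap.sum_apply, map_smul, LinearMap.smul_apply, smul_smul]
    simp only [Finset.smul_sum]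
    rw [Finset.sum_comm, ← Finset.sum_product']
    -- Labelling `|cons b hb α|` means choosing a label for the first block and a labelling of
    -- `|α|`.
    refine Finset.sum_nbij (fun x => GComp.cons (b.1, x.1) hb x.2) ?_ ?_ ?_ ?_
    · rintro ⟨h, p⟩ hp
      simp only [Finset.mem_product, Finset.mem_filter, Finset.mem_univ, true_and] at hp ⊢
      exact Composition.ext (congrArg (fun c : Composition n => b.1 :: c.blocks) hp)
    · rintro ⟨h, p⟩ _ ⟨h', p'⟩ _ he
      have := congrArg GComp.blocks he
      simp only [GComp.cons, List.cons.injEq, Prod.mk.injEq, true_and] at this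
      exact Prod.ext this.1 (GComp.ext this.2)
    · rintro p hp
      simp only [Finset.coe_filter, Finset.mem_univ, true_and, Set.mem_ofPred_eq] at hp
      obtain ⟨l, hl, hs⟩ := p
      have hl' : l.map Prod.fst = b.1 :: α.blocks.map Prod.fst := congrArg Composition.blocks hp
      obtain ⟨x, l, rfl, hx, ht⟩ := List.map_eq_cons_iff.1 hl'
      obtain ⟨a, h⟩ := x
      subst hx
      refine ⟨(h, ⟨l, fun c hc => hl c (by simp [hc]), by simpa using hs⟩), ?_, rfl⟩
      exact Finset.mem_coe.2 (Finset.mem_product.2 ⟨Finset.mem_univ _,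
        Finset.mem_filter.2 ⟨Finset.mem_univ _, Composition.ext ht⟩⟩)
    · rintro ⟨h, p⟩ _
      have he : eval (GComp.cons b hb α) (GComp.cons (b.1, h) hb p) =
          ((b.2 h : ℂˣ) : ℂ) * eval α p := by simp [eval, GComp.cons]
      have hr : reutProd (GComp.cons (b.1, h) hb p).blocks =
          star (incl b.1 (reut h b.1)) (reutProd p.blocks) := rfl
      have hlen : (GComp.cons b hb α).length = α.length + 1 := rfl
      simp only [he, hr, hlen, map_mul, smul_smul, pow_succ]
      congr 1
      ring

end MR

end
open scoped Classical in
theorem corollary7p8 (n : ℕ) (lam : MR.GPart MR.C2Dual n) :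
    MR.vazirani lam =
      MR.incl n ((1 / ((2 : ℂ) ^ lam.length * (lam.length.factorial : ℂ))) •
        ∑ α : MR.GComp MR.C2Dual n with α.supp = lam,
          ∑ p : MR.GComp MR.C2 n with p.abs = α.abs,
            (starRingEnd ℂ) (MR.eval α p) •
              ∑ q : MR.GComp MR.C2 n with p ≤ q,
                ((-1 : ℂ) ^ (q.length - p.length) / (MR.deg q.abs p.abs : ℂ)) • MR.X q) := by
  rw [MR.vazirani, map_smul, map_sum, Finset.smul_sum, Finset.smul_sum]
  refine Finset.sum_congr rfl fun α hα => ?_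
  -- All `α` with support `lam` have the same length, so the power of `1/2` is common to all terms.
  have hlen : α.length = lam.length := by
    rw [← (Finset.mem_filter.1 hα).2]
    rfl
  rw [MR.I_eq, hlen, smul_smul, map_sum]
  congr 1
  · rw [one_div_pow, one_div_mul_one_div, mul_comm]
  · refine Finset.sum_congr rfl fun p _ => ?_
    rw [MR.reutProd_eq, map_smul]
    rfl
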